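/- Let $R$ be a commutative ring and let $x,y,\lambda\in R$; for instance, $R=\mathbb{Z}[x,y,\lambda]$ with $x,y,\lambda$ indeterminates. For $n\ge 0$ let $\mathcal{D}_n$ be the set of derangements of $[n]=\{1,\dots,n\}$ (permutations $\sigma$ with $\sigma(i)\ne i$ for all $i$), and put $$D_n(x,y,\lambda)=\sum_{\sigma\in\mathcal{D}_n}\lambda^{\mathrm{cyc}(\sigma)}x^{\mathrm{rlm}(\sigma)}y^{\mathrm{exc}(\sigma)},$$ where $\mathrm{cyc}(\sigma)$ is the number of cycles of $\sigma$, $\mathrm{rlm}(\sigma)$ is the number of right-to-left minima (indices $i$ with $\sigma(i)<\sigma(j)$ for all $j>i$), and $\mathrm{exc}(\sigma)$ is the number of excedances (indices $i$ with $\sigma(i)>i$). In particular $D_0=1$. Then the ordinary generating function of these polynomials is given by the J-fraction $$\sum_{n=0}^\infty D_n(x,y,\lambda)\,t^n=\cfrac{1}{1-\gamma_0 t-\cfrac{\beta_1 t^2}{1-\gamma_1 t-\cfrac{\beta_2 t^2}{1-\gamma_2 t-\cdots}}}$$ with $\gamma_0=0$ and, for $n\ge1$, $$\gamma_n=x+ny+n-1,\qquad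 \beta_n=(\lambda+n-1)(x+n-1)y.$$ The identity is one of formal power series in $t$ over $R$: for every $m$, the coefficient of $t^m$ in the finite fraction obtained by ending the continued fraction with the row $1-\gamma_k t$ equals $D_m(x,y,\lambda)$ for all sufficiently large $k$. -/

import Mathlib

/-- Number of excedances of `σ`: indices `i` with `σ i > i`. -/
def exc {n : ℕ} (σ : Equiv.Perm (Fin n)) : ℕ :=
  (Finset.univ.filter fun i : Fin n => i < σ i).card

/-- Number of right-to-left minima of `σ`: indices `i` with `σ i < σ j` for all `j > i`. -/
def rlm {n : ℕ} (σ : Equiv.Perm (Fin n)) : ℕ :=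
  (Finset.univ.filter fun i : Fin n => ∀ j : Fin n, i < j → σ i < σ j).card

/-- Number of cycles of `σ`, where fixed points count as cycles of length one. -/
def cyc {n : ℕ} (σ : Equiv.Perm (Fin n)) : ℕ :=
  σ.partition.parts.card

/-- The polynomial `D_n(x, y, l) = ∑ l ^ cyc σ * x ^ rlm σ * y ^ exc σ`, the sum being over all
derangements `σ` of `n` letters, evaluated at elements `x`, `y`, `l` of a commutative ring. -/
def derangementPoly {R : Type*} [CommRing R] (n : ℕ) (x y l : R) : R :=
  ∑ σ ∈ Finset.univ.filter (fun σ : Equiv.Perm (Fin n) => σ ∈ derangements (Fin n)),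
    l ^ cyc σ * x ^ rlm σ * y ^ exc σ

/-- The finite J-fraction with rows `s, s + 1, …, s + k`, as a formal power series in `t`:
`1 / (1 - γ_s t - β_{s+1} t² / (1 - γ_{s+1} t - ⋯ - β_{s+k} t² / (1 - γ_{s+k} t)))`.
Each denominator has constant term `1`, so `PowerSeries.invOfUnit _ 1` is its actual inverse. -/
noncomputable def jConvergent {R : Type*} [CommRing R] (γ β : ℕ → R) :
    ℕ → ℕ → PowerSeries R
  | s, 0 => PowerSeries.invOfUnit (1 - PowerSeries.C (γ s) * PowerSeries.X) 1
  | s, k + 1 => PowerSeries.invOfUnit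
      (1 - PowerSeries.C (γ s) * PowerSeries.X
        - PowerSeries.C (β (s + 1)) * PowerSeries.X ^ 2 * jConvergent γ β (s + 1) k) 1

/-- `F` is the value of the infinite J-fraction
`1 / (1 - γ_0 t - β_1 t² / (1 - γ_1 t - β_2 t² / ⋯))`: the finite J-fractions obtained by
truncation converge to `F` as formal power series, that is, every coefficient is eventually
constant and equal to that of `F`. -/
def IsJFraction {R : Type*} [CommRing R] (F : PowerSeries R) (γ β : ℕ → R) : Prop :=
  ∀ m : ℕ, ∀ᶠ k in Filter.atTop,
    PowerSeries.coeff m (jConvergent γ β 0 k) = PowerSeries.coeff m F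

/-! Read the letters from left to right. The letters already read form complete cycles and some
number `k` of unfinished paths, each lacking a preimage for its first letter and an image for its
last. Contract each path to one letter, ordered by first letters, and discard the cycles: what
remains is a derangement sending each of `0, …, k - 1` to a letter `≥ k`. `openSum` sums over these,
with `rlm` and `exc` counted only at positions still to be read.

The next letter `k` has four options. Preimage and image not smaller: a path opens, with weight `y`
for the excedance. Only the preimage smaller: one of `k` paths is prolonged, weight `k * y`. Only
the image smaller: weight `x + k - 1`, because all letters below `k` are still unused as values, so
position `k` is a right-to-left minimum exactly when it takes `0`. Both smaller: weight `(l + k - 1)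
* (x + k - 1)`, since for each image exactly one of the `k` possible preimages closes a cycle.

This is `openSum_succ_succ`, the recursion for weighted Motzkin paths, which
`isJFraction_of_recursion` turns into the continued fraction. `insertEntry` is the inverse of the
contraction. -/

/-! ### J-fractions from Motzkin-type recursions -/

open PowerSeries in
theorem constantCoeff_jFraction_denominator {R : Type*} [CommRing R] (g b : R) (F : R⟦X⟧) :
    constantCoeff (1 - C g * X - C b * X ^ 2 * F) = ((1 : Rˣ) : R) := by
  simp

open PowerSeries in
theorem jConvergent_succ_mul {R : Type*} [CommRing R] (γ β : ℕ → R) (s k : ℕ) :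
    jConvergent γ β s (k + 1) *
      (1 - C (γ s) * X - C (β (s + 1)) * X ^ 2 * jConvergent γ β (s + 1) k) = 1 := by
  rw [jConvergent]
  exact invOfUnit_mul _ _ (constantCoeff_jFraction_denominator _ _ _)

open PowerSeries in
/-- Weighted Motzkin paths: if `h s m` satisfies the recursion of the paths of length `m` from
height `s` to height `0`, then the generating function of `h 0` is a J-fraction. -/
theorem isJFraction_of_recursion {R : Type*} [CommRing R] (γ β u d : ℕ → R)
    (h : ℕ → ℕ → R) (hβ : ∀ s, u s * d (s + 1) = β (s + 1)) (h0 : h 0 0 = 1)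
    (hs0 : ∀ s, h (s + 1) 0 = 0)
    (h0m : ∀ m, h 0 (m + 1) = u 0 * h 1 m + γ 0 * h 0 m)
    (hsm : ∀ s m, h (s + 1) (m + 1) =
      u (s + 1) * h (s + 2) m + γ (s + 1) * h (s + 1) m + d (s + 1) * h s m) :
    IsJFraction (mk (h 0)) γ β := by
  have e0 : mk (h 0) = 1 + X * (C (u 0) * mk (h 1) + C (γ 0) * mk (h 0)) := by
    ext m
    cases m with
    | zero => simp [h0]
    | succ m => simp [coeff_succ_X_mul, coeff_one, h0m]
  have es : ∀ s, mk (h (s + 1)) = X * (C (u (s + 1)) * mk (h (s + 2)) +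
      C (γ (s + 1)) * mk (h (s + 1)) + C (d (s + 1)) * mk (h s)) := by
    intro s
    ext m
    cases m with
    | zero => simp [hs0]
    | succ m => simp [coeff_succ_X_mul, hsm]
  have hβC : ∀ s, C (β (s + 1)) = C (u s) * C (d (s + 1)) := fun s => by
    rw [← map_mul, hβ]
  -- A path from height `s + 1` splits at its first descent to `s`; the convergent approximates the
  -- part before that descent.
  have key : ∀ j s, ∃ r, mk (h (s + 1)) =
      C (d (s + 1)) * X * jConvergent γ β (s + 1) j * mk (h s) + X ^ j * r := by
    intro j
    induction j with
    | zero =>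
      intro s
      exact ⟨mk (h (s + 1)) - C (d (s + 1)) * X * jConvergent γ β (s + 1) 0 * mk (h s),
        by ring⟩
    | succ j ih =>
      intro s
      obtain ⟨r, hr⟩ := ih (s + 1)
      -- Substituting the approximation one level up into `es s` multiplies its error by `X * C (u
      -- (s + 1))`; solving for `mk (h (s + 1))` divides by the denominator of the convergent.
      refine ⟨jConvergent γ β (s + 1) (j + 1) * C (u (s + 1)) * r, ?_⟩
      have hJ := jConvergent_succ_mul γ β (s + 1) j
      rw [hβC] at hJ
      linear_combination (-mk (h (s + 1))) * hJ + jConvergent γ β (s + 1) (j + 1) * es s +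
        jConvergent γ β (s + 1) (j + 1) * X * C (u (s + 1)) * hr
  have key0 : ∀ j, ∃ r, mk (h 0) = jConvergent γ β 0 (j + 1) + X ^ (j + 1) * r := by
    intro j
    obtain ⟨r, hr⟩ := key j 0
    refine ⟨jConvergent γ β 0 (j + 1) * C (u 0) * r, ?_⟩
    have hJ := jConvergent_succ_mul γ β 0 j
    rw [hβC] at hJ
    linear_combination (-mk (h 0)) * hJ + jConvergent γ β 0 (j + 1) * e0 +
      jConvergent γ β 0 (j + 1) * X * C (u 0) * hr
  intro m
  filter_upwards [Filter.eventually_gt_atTop m] with k hk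
  obtain ⟨j, rfl⟩ := Nat.exists_eq_succ_of_ne_zero (Nat.ne_zero_of_lt hk)
  obtain ⟨r, hr⟩ := key0 j
  rw [hr, map_add, coeff_X_pow_mul', if_neg (by omega), add_zero]

/-! ### Inserting a letter and counting cycles -/

open Equiv

theorem card_parts_partition {α : Type*} [Fintype α] [DecidableEq α] (σ : Perm α) :
    σ.partition.parts.card + σ.support.card = σ.cycleType.card + Fintype.card α := by
  have h := σ.support.card_le_univ
  rw [Perm.parts_partition, Multiset.card_add, Multiset.card_replicate]
  omega

/-- Cutting a nontrivial cycle next to `b` splits off `b` as a fixed point. -/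
theorem card_parts_partition_swap_mul {α : Type*} [Fintype α] [DecidableEq α] (τ : Perm α)
    (b : α) (hb : τ b ≠ b) :
    (swap b (τ b) * τ).partition.parts.card = τ.partition.parts.card + 1 := by
  have hc : (τ.cycleOf b).IsCycle := Perm.isCycle_cycleOf τ hb
  have hcb : τ.cycleOf b b = τ b := Perm.cycleOf_apply_self τ b
  have hmem : τ.cycleOf b ∈ τ.cycleFactorsFinset := by
    rwa [Perm.cycleOf_mem_cycleFactorsFinset_iff, Perm.mem_support]
  have hd := Perm.disjoint_mul_inv_of_mem_cycleFactorsFinset hmem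
  generalize hdd : τ * (τ.cycleOf b)⁻¹ = d at hd
  generalize τ.cycleOf b = c at *
  have hτ : τ = c * d := by rw [← hd.commute.eq, ← hdd, inv_mul_cancel_right]
  have hct := hd.symm.cycleType_mul
  have hst := hd.symm.card_support_mul
  rw [← hτ] at hct hst
  have h1 := card_parts_partition τ
  have h2 := card_parts_partition (swap b (τ b) * τ)
  rw [hct, hc.cycleType, Multiset.card_add, Multiset.card_singleton] at h1
  have hmul : swap b (τ b) * τ = swap b (c b) * c * d := by
    rw [hcb, mul_assoc, ← hτ]
  have hcb' : c b ≠ b := hcb ▸ hb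
  -- Cutting a 2-cycle leaves only fixed points, so no shorter nontrivial cycle survives; otherwise
  -- the cycle loses just `b`.
  by_cases hcc : c (c b) = b
  · have hsw := hc.eq_swap_of_apply_apply_eq_self hcb' hcc
    have hone : swap b (c b) * c = 1 := by
      conv_lhs => rw [hsw]
      simp
    have hcard : c.support.card = 2 := by
      rw [hsw]
      exact Perm.card_support_swap hcb'.symm
    rw [hmul, hone, one_mul] at h2 ⊢
    omega
  · have hcyc := hc.swap_mul hcb' hcc
    have hs := Perm.support_swap_mul_eq c b hcc
    have hdis : Perm.Disjoint (swap b (c b) * c) d := by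
      rw [Perm.disjoint_iff_disjoint_support, hs]
      exact (Perm.disjoint_iff_disjoint_support.1 hd.symm).mono_left Finset.sdiff_subset
    have hscard : (swap b (c b) * c).support.card + 1 = c.support.card := by
      rw [hs, Finset.sdiff_singleton_eq_erase]
      exact Finset.card_erase_add_one (Perm.mem_support.2 hcb')
    rw [hmul] at h2 ⊢
    rw [hdis.cycleType_mul, hdis.card_support_mul, hcyc.cycleType, Multiset.card_add,
      Multiset.card_singleton] at h2
    omega

/-- Extend a permutation of `n` letters to one of `n + 1` letters which fixes `b`. -/
def extendFix {n : ℕ} (b : Fin (n + 1)) (ρ : Perm (Fin n)) : Perm (Fin (n + 1)) :=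
  ρ.extendDomain (finSuccAboveEquiv b)

theorem extendFix_self {n : ℕ} (b : Fin (n + 1)) (ρ : Perm (Fin n)) : extendFix b ρ b = b :=
  Perm.extendDomain_apply_not_subtype _ _ (by simp)

theorem extendFix_succAbove {n : ℕ} (b : Fin (n + 1)) (ρ : Perm (Fin n)) (i : Fin n) :
    extendFix b ρ (b.succAbove i) = b.succAbove (ρ i) :=
  Perm.extendDomain_apply_image ρ (finSuccAboveEquiv b) i

theorem cyc_extendFix {n : ℕ} (b : Fin (n + 1)) (ρ : Perm (Fin n)) :
    cyc (extendFix b ρ) = cyc ρ + 1 := by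
  have h1 := card_parts_partition ρ
  have h2 := card_parts_partition (extendFix b ρ)
  have h3 : (extendFix b ρ).cycleType = ρ.cycleType := Perm.cycleType_extendDomain _
  rw [← Perm.sum_cycleType, h3] at h2
  rw [← Perm.sum_cycleType] at h1
  simp only [Fintype.card_fin] at h1 h2
  unfold cyc
  omega

theorem exists_extendFix {n : ℕ} (b : Fin (n + 1)) (σ : Perm (Fin (n + 1))) (h : σ b = b) :
    ∃ ρ, extendFix b ρ = σ := by
  have hσ : ∀ x, x ≠ b ↔ σ x ≠ b := fun x => by
    rw [not_iff_not]
    exact ⟨fun hx => hx ▸ h, fun hx => σ.injective (hx.trans h.symm)⟩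
  refine ⟨(finSuccAboveEquiv b).symm.permCongr (σ.subtypePerm fun x => (hσ x).symm), ?_⟩
  ext1 x
  rcases Fin.eq_self_or_eq_succAbove b x with rfl | ⟨j, rfl⟩
  · rw [extendFix_self, h]
  · rw [extendFix_succAbove]
    change (finSuccAboveEquiv b _ : Fin (n + 1)) = _
    simp [permCongr_apply, finSuccAboveEquiv_apply]

/-- Insert a letter into a permutation of `n` letters in such a way that the result maps `a`
to `b`. -/
def insertEntry {n : ℕ} (a b : Fin (n + 1)) (ρ : Perm (Fin n)) : Perm (Fin (n + 1)) :=
  extendFix b ρ * swap a b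

theorem insertEntry_left {n : ℕ} (a b : Fin (n + 1)) (ρ : Perm (Fin n)) :
    insertEntry a b ρ a = b := by
  simp [insertEntry, extendFix_self]

theorem insertEntry_right {n : ℕ} (a b : Fin (n + 1)) (ρ : Perm (Fin n)) (j : Fin n)
    (hj : b.succAbove j = a) : insertEntry a b ρ b = b.succAbove (ρ j) := by
  simp [insertEntry, ← hj, extendFix_succAbove]

theorem insertEntry_succAbove {n : ℕ} (a b : Fin (n + 1)) (ρ : Perm (Fin n)) (j : Fin n)
    (hj : b.succAbove j ≠ a) : insertEntry a b ρ (b.succAbove j) = b.succAbove (ρ j) := by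
  rw [insertEntry, Perm.mul_apply, swap_apply_of_ne_of_ne hj (Fin.succAbove_ne _ _),
    extendFix_succAbove]

theorem extendFix_injective {n : ℕ} (b : Fin (n + 1)) : Function.Injective (extendFix b) := by
  intro ρ ρ' h
  ext1 i
  apply Fin.succAbove_right_injective (p := b)
  rw [← extendFix_succAbove, ← extendFix_succAbove, h]

theorem insertEntry_injective {n : ℕ} (a b : Fin (n + 1)) :
    Function.Injective (insertEntry a b) :=
  (mul_left_injective (swap a b)).comp (extendFix_injective b)

theorem exists_insertEntry {n : ℕ} (a b : Fin (n + 1)) (τ : Perm (Fin (n + 1)))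
    (h : τ a = b) : ∃ ρ, insertEntry a b ρ = τ := by
  obtain ⟨ρ, hρ⟩ := exists_extendFix b (τ * swap a b) (by simpa using h)
  exact ⟨ρ, by rw [insertEntry, hρ, mul_assoc, swap_mul_self, mul_one]⟩

/-- Adding the fixed point `b` creates a cycle, and the factor `swap a b` merges it into the cycle
of `a` unless `a = b`. This is the source of `l` in `β`. -/
theorem cyc_insertEntry {n : ℕ} (a b : Fin (n + 1)) (ρ : Perm (Fin n)) :
    cyc (insertEntry a b ρ) = cyc ρ + if a = b then 1 else 0 := by
  split_ifs with h
  · rw [insertEntry, h, swap_self, ← cyc_extendFix b]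
    rfl
  · have hb : insertEntry a b ρ b ≠ b := fun hb =>
      h ((insertEntry a b ρ).injective ((insertEntry_left a b ρ).trans hb.symm))
    have h1 : cyc (extendFix b ρ) = cyc (insertEntry a b ρ) + 1 := by
      rw [cyc, cyc, ← card_parts_partition_swap_mul _ b hb]
      congr 3
      conv_lhs => rw [← mul_one (extendFix b ρ), ← swap_mul_self a b, ← mul_assoc]
      change insertEntry a b ρ * _ = _
      rw [mul_swap_eq_swap_mul, insertEntry_left]
    rw [cyc_extendFix] at h1
    omega

theorem sum_filter_apply_eq {R : Type*} [AddCommMonoid R] {n : ℕ} (a b : Fin (n + 1))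
    (P : Perm (Fin (n + 1)) → Prop) [DecidablePred P] (f : Perm (Fin (n + 1)) → R) :
    ∑ τ with P τ ∧ τ a = b, f τ =
      ∑ ρ : Perm (Fin n) with P (insertEntry a b ρ), f (insertEntry a b ρ) := by
  symm
  refine Finset.sum_bij (fun ρ _ => insertEntry a b ρ) ?_ ?_ ?_ ?_
  · intro ρ hρ
    simpa [insertEntry_left] using hρ
  · intro ρ _ ρ' _ h
    exact insertEntry_injective a b h
  · intro τ hτ
    simp only [Finset.mem_filter_univ] at hτ
    obtain ⟨ρ, rfl⟩ := exists_insertEntry a b τ hτ.2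
    exact ⟨ρ, by simpa using hτ.1, rfl⟩
  · intros
    rfl

/-! ### Open derangements and their behaviour under insertion -/

/-- Derangements of `n` letters which map the first `k` letters to the others. -/
def IsOpenDerangement {n : ℕ} (k : ℕ) (τ : Perm (Fin n)) : Prop :=
  ∀ i : Fin n, (i.val < k → k ≤ (τ i).val) ∧ τ i ≠ i

/-- The conditions of `IsOpenDerangement`, except at the letter `a`. -/
def IsOpenDerangementOff {n : ℕ} (k a : ℕ) (τ : Perm (Fin n)) : Prop :=
  ∀ i : Fin n, i.val ≠ a → (i.val < k → k ≤ (τ i).val) ∧ τ i ≠ i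

instance {n : ℕ} (k : ℕ) (τ : Perm (Fin n)) : Decidable (IsOpenDerangement k τ) := by
  unfold IsOpenDerangement
  infer_instance

instance {n : ℕ} (k a : ℕ) (τ : Perm (Fin n)) : Decidable (IsOpenDerangementOff k a τ) := by
  unfold IsOpenDerangementOff
  infer_instance

/-- Right-to-left minima among the positions from `k` on. -/
def rlmFrom {n : ℕ} (k : ℕ) (τ : Perm (Fin n)) : ℕ :=
  (Finset.univ.filter fun i : Fin n => k ≤ i.val ∧ ∀ j : Fin n, i < j → τ i < τ j).card

/-- Excedances among the positions from `k` on. -/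
def excFrom {n : ℕ} (k : ℕ) (τ : Perm (Fin n)) : ℕ :=
  (Finset.univ.filter fun i : Fin n => k ≤ i.val ∧ i < τ i).card

theorem Fin.val_succAbove {n : ℕ} (b : Fin (n + 1)) (j : Fin n) :
    (b.succAbove j).val = if j.val < b.val then j.val else j.val + 1 := by
  rw [Fin.succAbove]
  simp only [Fin.lt_def, Fin.val_castSucc]
  split_ifs <;> simp

theorem succAbove_of_le {n : ℕ} {b : Fin (n + 1)} {j : Fin n} (h : b.val ≤ j.val) :
    b.succAbove j = j.succ :=
  Fin.succAbove_of_le_castSucc _ _ (by simpa [Fin.le_def] using h)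

theorem insertEntry_succ {n : ℕ} {a b : Fin (n + 1)} (ρ : Perm (Fin n)) {j : Fin n}
    (ha : a.val ≤ j.val) (hb : b.val ≤ j.val) :
    insertEntry a b ρ j.succ = b.succAbove (ρ j) := by
  rw [← succAbove_of_le hb]
  apply insertEntry_succAbove
  rw [succAbove_of_le hb, ne_eq, Fin.ext_iff, Fin.val_succ]
  omega

/-- Past `a` and `b`, insertion shifts positions by one and relabels values by the increasing map
`b.succAbove`, so comparisons survive. -/
theorem excFrom_insertEntry {n k : ℕ} {a b : Fin (n + 1)} (ha : a.val ≤ k) (hb : b.val ≤ k)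
    (ρ : Perm (Fin n)) : excFrom (k + 1) (insertEntry a b ρ) = excFrom k ρ := by
  rw [excFrom, Fin.card_filter_univ_succ, if_neg (by simp), excFrom]
  congr 1
  ext j
  simp only [Finset.mem_filter_univ, Fin.val_succ, Nat.add_le_add_iff_right]
  refine and_congr_right fun hj => ?_
  rw [insertEntry_succ ρ (ha.trans hj) (hb.trans hj),
    ← succAbove_of_le (hb.trans hj), Fin.succAbove_lt_succAbove_iff]

theorem rlmFrom_insertEntry {n k : ℕ} {a b : Fin (n + 1)} (ha : a.val ≤ k) (hb : b.val ≤ k)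
    (ρ : Perm (Fin n)) : rlmFrom (k + 1) (insertEntry a b ρ) = rlmFrom k ρ := by
  rw [rlmFrom, Fin.card_filter_univ_succ, if_neg (by simp), rlmFrom]
  congr 1
  ext j
  simp only [Finset.mem_filter_univ, Fin.val_succ, Nat.add_le_add_iff_right]
  refine and_congr_right fun hj => ?_
  rw [Fin.forall_fin_succ]
  simp only [Fin.not_lt_zero, false_imp_iff, true_and, Fin.succ_lt_succ_iff]
  refine forall_congr' fun i => imp_congr_right fun hi => ?_
  have hi' : k ≤ i.val := hj.trans (Fin.lt_def.1 hi).le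
  rw [insertEntry_succ ρ (ha.trans hj) (hb.trans hj),
    insertEntry_succ ρ (ha.trans hi') (hb.trans hi'), Fin.succAbove_lt_succAbove_iff]

/-- Joining the end of path `a` to the start of path `b` uses up one of `k + 1` open paths. Position
`b` then takes over the pending image of the merged path. -/
theorem isOpenDerangementOff_insertEntry {n k : ℕ} {a b : Fin (n + 1)} (ha : a.val ≤ k)
    (hb : b.val ≤ k) (ρ : Perm (Fin n)) :
    IsOpenDerangementOff (k + 1) a.val (insertEntry a b ρ) ↔ IsOpenDerangement k ρ := by
  have hval : ∀ v : Fin n, k + 1 ≤ (b.succAbove v).val ↔ k ≤ v.val := fun v => by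
    rw [Fin.val_succAbove]; split_ifs <;> omega
  constructor
  · intro h j
    by_cases hj : b.succAbove j = a
    · have hab : b.val ≠ a.val := fun hab => Fin.succAbove_ne b j (hj.trans (Fin.ext hab.symm))
      have := (h b hab).1 (by omega)
      rw [insertEntry_right a b ρ j hj, hval] at this
      refine ⟨fun _ => this, fun hjj => ?_⟩
      rw [hjj] at this
      have h1 := congrArg Fin.val hj
      rw [succAbove_of_le (hb.trans this), Fin.val_succ] at h1
      omega
    · have := h (b.succAbove j) (fun h' => hj (Fin.ext h'))
      rw [insertEntry_succAbove a b ρ j hj, hval, (Fin.succAbove_right_injective).ne_iff] at this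
      refine ⟨fun hjk => this.1 ?_, this.2⟩
      have := (hval j).not.2 (by omega)
      omega
  · intro h i hi
    rcases Fin.eq_self_or_eq_succAbove b i with rfl | ⟨j, rfl⟩
    · obtain ⟨j, hj⟩ := Fin.exists_succAbove_eq (x := a) (y := i) (fun h => hi (by rw [h]))
      have hjk : j.val < k := by
        have h1 := congrArg Fin.val hj
        rw [Fin.val_succAbove] at h1
        split_ifs at h1 <;> omega
      have h2 := (h j).1 hjk
      rw [insertEntry_right a i ρ j hj, hval]
      exact ⟨fun _ => h2, Fin.succAbove_ne _ _⟩
    · rw [insertEntry_succAbove a b ρ j (fun h' => hi (by rw [h'])), hval,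
        (Fin.succAbove_right_injective).ne_iff]
      refine ⟨fun hjk => (h j).1 ?_, (h j).2⟩
      have := (hval j).not.1 (by omega)
      omega

/-- Contracting `a → k` frees the image of `a`: it becomes the former image of `k`, which may be any
letter, even `a` itself. -/
theorem isOpenDerangement_insertEntry {n : ℕ} (a : Fin n) (k : Fin (n + 1)) (hak : a.val < k.val)
    (ρ : Perm (Fin n)) :
    IsOpenDerangement k.val (insertEntry a.castSucc k ρ) ↔
      IsOpenDerangementOff k.val a.val ρ := by
  have hval : ∀ v : Fin n, k.val ≤ (k.succAbove v).val ↔ k.val ≤ v.val := fun v => by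
    rw [Fin.val_succAbove]; split_ifs <;> omega
  have hka : k.succAbove a = a.castSucc :=
    Fin.succAbove_of_castSucc_lt _ _ (by simpa [Fin.lt_def] using hak)
  have hne : ∀ j : Fin n, j.val ≠ a.val → k.succAbove j ≠ a.castSucc := fun j hj h =>
    hj (congrArg Fin.val (Fin.succAbove_right_injective (h.trans hka.symm)))
  constructor
  · intro h j hj
    have := h (k.succAbove j)
    rw [insertEntry_succAbove _ _ ρ j (hne j hj), hval,
      (Fin.succAbove_right_injective).ne_iff] at this
    refine ⟨fun hjk => this.1 ?_, this.2⟩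
    have := (hval j).not.2 (by omega)
    omega
  · intro h i
    rcases Fin.eq_self_or_eq_succAbove k i with rfl | ⟨j, rfl⟩
    · rw [insertEntry_right _ _ ρ a hka]
      exact ⟨fun h => absurd h (lt_irrefl _), Fin.succAbove_ne _ _⟩
    · by_cases hj : j.val = a.val
      · obtain rfl := Fin.ext hj
        rw [hka, insertEntry_left]
        refine ⟨fun _ => le_rfl, fun hk => ?_⟩
        have := congrArg Fin.val hk
        simp only [Fin.val_castSucc] at this
        omega
      · rw [insertEntry_succAbove _ _ ρ j (hne j hj), hval,
          (Fin.succAbove_right_injective).ne_iff]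
        refine ⟨fun hjk => (h j hj).1 ?_, (h j hj).2⟩
        have := (hval j).not.1 (by omega)
        omega

/-! ### Weights and the choices at one position -/

/-- The weight in which positions before `k` do not contribute to `rlm` and `exc`. -/
def weightFrom {R : Type*} [CommRing R] (x y l : R) {n : ℕ} (k : ℕ) (τ : Perm (Fin n)) : R :=
  l ^ cyc τ * x ^ rlmFrom k τ * y ^ excFrom k τ

/-- The weighted sum of all derangements of `n` letters which map the first `k` letters to the
others. -/
def openSum {R : Type*} [CommRing R] (x y l : R) (n k : ℕ) : R :=
  ∑ τ : Perm (Fin n) with IsOpenDerangement k τ, weightFrom x y l k τ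

theorem weightFrom_insertEntry {R : Type*} [CommRing R] (x y l : R) {n k : ℕ} {a b : Fin (n + 1)}
    (ha : a.val ≤ k) (hb : b.val ≤ k) (ρ : Perm (Fin n)) :
    weightFrom x y l (k + 1) (insertEntry a b ρ) =
      (if a = b then l else 1) * weightFrom x y l k ρ := by
  rw [weightFrom, weightFrom, excFrom_insertEntry ha hb, rlmFrom_insertEntry ha hb,
    cyc_insertEntry, pow_add, pow_ite]
  split_ifs <;> ring

theorem sum_isOpenDerangementOff {R : Type*} [CommRing R] (x y l : R) {n k : ℕ}
    {a b : Fin (n + 1)} (ha : a.val ≤ k) (hb : b.val ≤ k) :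
    ∑ τ with IsOpenDerangementOff (k + 1) a.val τ ∧ τ a = b, weightFrom x y l (k + 1) τ =
      (if a = b then l else 1) * openSum x y l n k := by
  rw [sum_filter_apply_eq, openSum, Finset.mul_sum]
  simp only [isOpenDerangementOff_insertEntry ha hb, weightFrom_insertEntry x y l ha hb]

theorem card_filter_le_and {n : ℕ} (k : Fin n) (P : Fin n → Prop) [DecidablePred P] :
    (Finset.univ.filter fun i : Fin n => k.val ≤ i.val ∧ P i).card =
      (if P k then 1 else 0) + (Finset.univ.filter fun i : Fin n => k.val + 1 ≤ i.val ∧ P i).card := by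
  have : (Finset.univ.filter fun i : Fin n => k.val ≤ i.val ∧ P i) =
      (Finset.univ.filter fun i : Fin n => i = k ∧ P i) ∪
        (Finset.univ.filter fun i : Fin n => k.val + 1 ≤ i.val ∧ P i) := by
    ext i
    simp only [Finset.mem_filter_univ, Finset.mem_union, Fin.ext_iff]
    by_cases P i <;> simp_all
    omega
  rw [this, Finset.card_union_of_disjoint]
  · congr 1
    split_ifs with h
    · rw [Finset.card_eq_one]
      refine ⟨k, ?_⟩
      ext i
      simp only [Finset.mem_filter_univ, Finset.mem_singleton]
      exact ⟨fun hi => hi.1, fun hi => ⟨hi, hi ▸ h⟩⟩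
    · rw [Finset.card_eq_zero, Finset.filter_eq_empty_iff]
      rintro i - ⟨rfl, hi⟩
      exact h hi
  · rw [Finset.disjoint_filter]
    rintro i - ⟨rfl, -⟩ ⟨hi, -⟩
    omega

/-- The contribution of a position to the weight, in terms of the letter `v` found there, when
the smallest available letter is `0` and the excedance letters are those from `k` on. -/
def entryWeight {R : Type*} [CommRing R] (x y : R) (k v : ℕ) : R :=
  if k ≤ v then y else if v = 0 then x else 1

/-- Positions before `k` carry letters `≥ k`, so the letter `0` sits at position `k` or later, and
`k` is a right-to-left minimum only if it carries `0`. -/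
theorem weightFrom_eq_entryWeight_mul {R : Type*} [CommRing R] (x y l : R) {n : ℕ}
    (k : Fin (n + 1)) (τ : Perm (Fin (n + 1))) (h : IsOpenDerangement k.val τ) :
    weightFrom x y l k.val τ =
      entryWeight x y k.val (τ k).val * weightFrom x y l (k.val + 1) τ := by
  have hrlm : (∀ j, k < j → τ k < τ j) ↔ (τ k).val = 0 := by
    constructor
    · intro hk
      by_contra h0
      obtain ⟨p, hp⟩ := τ.surjective 0
      rcases lt_trichotomy p k with hpk | hpk | hpk
      · have h1 := (h p).1 hpk
        rw [hp] at h1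
        have h2 := Fin.lt_def.1 hpk
        simp only [Fin.val_zero] at h1
        omega
      · rw [← hpk, hp] at h0
        exact h0 rfl
      · have h1 := hk p hpk
        rw [hp] at h1
        exact Fin.not_lt_zero _ h1
    · intro h0 j hj
      have h1 : (τ j).val ≠ (τ k).val := fun h => hj.ne' (τ.injective (Fin.ext h))
      rw [Fin.lt_def]
      omega
  have hexc : k < τ k ↔ k.val ≤ (τ k).val := by
    have := (h k).2
    rw [ne_eq, Fin.ext_iff] at this
    rw [Fin.lt_def]
    omega
  rw [weightFrom, weightFrom, rlmFrom, card_filter_le_and, excFrom, card_filter_le_and]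
  change _ = _ * (_ * x ^ (rlmFrom (k.val + 1) τ) * y ^ (excFrom (k.val + 1) τ))
  change _ * x ^ (_ + rlmFrom (k.val + 1) τ) * y ^ (_ + excFrom (k.val + 1) τ) = _
  rw [pow_add, pow_add, entryWeight]
  have h2 := (h k).2
  rw [ne_eq, Fin.ext_iff] at h2
  simp only [hrlm, hexc]
  by_cases hk : k.val ≤ (τ k).val
  -- Even for `k = 0`, since `k` is not fixed; hence `x` and `y` never occur together.
  · have : (τ k).val ≠ 0 := by omega
    simp only [hk, this, if_true, if_false]
    ring
  · simp only [hk, if_false]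
    split_ifs <;> ring

/-- Serves both factors of `β`: with `c = x` for the choice of the image, with `c = l` for the
choice of the preimage. -/
theorem sum_filter_lt_ite_eq {R : Type*} [CommRing R] (c : R) {n k : ℕ} (hk : k ≤ n) (b : Fin n)
    (hb : b.val < k) :
    ∑ a : Fin n with a.val < k, (if a = b then c else 1) = c + (k : R) - 1 := by
  have h1 : ∀ a : Fin n, (if a = b then c else 1) = 1 + if a = b then c - 1 else 0 := fun a => by
    split_ifs <;> ring
  have h2 : b ∈ Finset.univ.filter fun a : Fin n => a.val < k := by simpa using hb
  simp only [h1, Finset.sum_add_distrib]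
  rw [Finset.sum_ite_eq' _ b, if_pos h2, Finset.sum_const, Fin.card_filter_val_lt, min_eq_right hk,
    nsmul_one]
  ring

theorem sum_entryWeight {R : Type*} [CommRing R] (x y : R) {n k : ℕ} (hk : k ≤ n) :
    ∑ b : Fin n with b.val < k, entryWeight x y k b.val =
      if k = 0 then 0 else x + (k : R) - 1 := by
  split_ifs with h0
  · simp [h0]
  · rw [← sum_filter_lt_ite_eq x hk ⟨0, by omega⟩ (by simp only; omega)]
    refine Finset.sum_congr rfl fun b hb => ?_
    simp only [Finset.mem_filter_univ] at hb
    simp only [entryWeight, Fin.ext_iff]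
    rw [if_neg (by omega)]

theorem isOpenDerangementOff_and_le_iff {n : ℕ} (k : ℕ) (a : Fin n) (ha : a.val < k)
    (ρ : Perm (Fin n)) :
    IsOpenDerangementOff k a.val ρ ∧ k ≤ (ρ a).val ↔ IsOpenDerangement k ρ := by
  constructor
  · rintro ⟨h, hk⟩ i
    by_cases hi : i.val = a.val
    · obtain rfl := Fin.ext hi
      refine ⟨fun _ => hk, fun hii => ?_⟩
      rw [hii] at hk
      omega
    · exact h i hi
  · exact fun h => ⟨fun i _ => h i, (h a).1 ha⟩

/-- Here `ρ a` is the image of the letter already contracted into `a`. If it is large, path `a`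
stays open; if it is some `b < k + 1`, a second contraction joins paths `a` and `b`, closing a cycle
when `a = b`. -/
theorem sum_entryWeight_mul_weightFrom {R : Type*} [CommRing R] (x y l : R) {n k : ℕ}
    (a : Fin (n + 1)) (ha : a.val ≤ k) :
    ∑ ρ with IsOpenDerangementOff (k + 1) a.val ρ,
        entryWeight x y (k + 1) (ρ a).val * weightFrom x y l (k + 1) ρ =
      y * openSum x y l (n + 1) (k + 1) +
        ∑ b : Fin (n + 1) with b.val < k + 1,
          entryWeight x y (k + 1) b.val * ((if a = b then l else 1) * openSum x y l n k) := by
  rw [← Finset.sum_filter_add_sum_filter_not _ fun ρ : Perm (Fin (n + 1)) => k + 1 ≤ (ρ a).val]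
  congr 1
  · rw [Finset.filter_filter, openSum, Finset.mul_sum]
    simp only [isOpenDerangementOff_and_le_iff (k + 1) a (by omega)]
    refine Finset.sum_congr rfl fun ρ hρ => ?_
    simp only [Finset.mem_filter_univ] at hρ
    rw [entryWeight, if_pos ((hρ a).1 (by omega))]
  · rw [Finset.filter_filter,
      ← Finset.sum_fiberwise_of_maps_to (g := fun ρ : Perm (Fin (n + 1)) => ρ a)
        (t := Finset.univ.filter fun b : Fin (n + 1) => b.val < k + 1)]
    · refine Finset.sum_congr rfl fun b hb => ?_
      simp only [Finset.mem_filter_univ] at hb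
      rw [← sum_isOpenDerangementOff x y l ha (by omega : b.val ≤ k), Finset.mul_sum,
        Finset.filter_filter]
      have hset : (Finset.univ.filter fun ρ : Perm (Fin (n + 1)) =>
          (IsOpenDerangementOff (k + 1) a.val ρ ∧ ¬k + 1 ≤ (ρ a).val) ∧ ρ a = b) =
          Finset.univ.filter fun ρ => IsOpenDerangementOff (k + 1) a.val ρ ∧ ρ a = b := by
        refine Finset.filter_congr fun ρ _ => ?_
        constructor
        · exact fun h => ⟨h.1.1, h.2⟩
        · rintro ⟨h, rfl⟩
          exact ⟨⟨h, by omega⟩, rfl⟩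
      rw [hset]
      refine Finset.sum_congr rfl fun ρ hρ => ?_
      simp only [Finset.mem_filter_univ] at hρ
      rw [hρ.2]
    · intro ρ hρ
      simp only [Finset.mem_filter_univ] at hρ ⊢
      omega

/-! ### The recursion, by preimage and image of the letter `k` -/

/-- The part of `openSum` in which the letter `k` is the image of a smaller letter. -/
theorem sum_symm_lt {R : Type*} [CommRing R] (x y l : R) {n : ℕ} (k : Fin (n + 1)) :
    ∑ τ with IsOpenDerangement k.val τ ∧ τ.symm k < k, weightFrom x y l k.val τ =
      ∑ a : Fin n with a.val < k.val, ∑ ρ with IsOpenDerangementOff k.val a.val ρ,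
        entryWeight x y k.val (ρ a).val * weightFrom x y l k.val ρ := by
  have hmem : ∀ a : Fin (n + 1), a < k ↔
      a ∈ (Finset.univ.filter fun a : Fin n => a.val < k.val).map Fin.castSuccEmb := by
    intro a
    simp only [Finset.mem_map, Finset.mem_filter_univ, Fin.coe_castSuccEmb]
    constructor
    · intro h
      have := Fin.lt_def.1 h
      exact ⟨⟨a.val, by omega⟩, this, rfl⟩
    · rintro ⟨b, hb, rfl⟩
      exact hb
  rw [← Finset.sum_fiberwise_of_maps_to (g := fun τ : Perm (Fin (n + 1)) => τ.symm k)
    (t := (Finset.univ.filter fun a : Fin n => a.val < k.val).map Fin.castSuccEmb)]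
  · rw [Finset.sum_map]
    refine Finset.sum_congr rfl fun a ha => ?_
    simp only [Finset.mem_filter_univ] at ha
    rw [Finset.filter_filter]
    have hset : (Finset.univ.filter fun τ : Perm (Fin (n + 1)) =>
        (IsOpenDerangement k.val τ ∧ τ.symm k < k) ∧ τ.symm k = Fin.castSuccEmb a) =
        Finset.univ.filter fun τ => IsOpenDerangement k.val τ ∧ τ a.castSucc = k := by
      refine Finset.filter_congr fun τ _ => ?_
      rw [symm_apply_eq, Fin.coe_castSuccEmb]
      constructor
      · exact fun h => ⟨h.1.1, h.2.symm⟩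
      · rintro ⟨h, hk⟩
        refine ⟨⟨h, ?_⟩, hk.symm⟩
        rw [τ.symm_apply_eq.2 hk.symm]
        exact ha
    rw [hset, sum_filter_apply_eq]
    simp only [isOpenDerangement_insertEntry a k ha]
    refine Finset.sum_congr rfl fun ρ hρ => ?_
    simp only [Finset.mem_filter_univ] at hρ
    have hka : k.succAbove a = a.castSucc :=
      Fin.succAbove_of_castSucc_lt _ _ (by simpa [Fin.lt_def] using ha)
    rw [weightFrom_eq_entryWeight_mul x y l k _
      ((isOpenDerangement_insertEntry a k ha ρ).2 hρ),
      weightFrom_insertEntry x y l (by simpa using ha.le) le_rfl,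
      if_neg (fun h => by simp [Fin.ext_iff] at h; omega), one_mul,
      insertEntry_right _ _ ρ a hka]
    congr 1
    -- `k.succAbove` fixes letters below `k` and keeps the others at least `k`.
    rw [entryWeight, entryWeight, Fin.val_succAbove]
    split_ifs <;> first | rfl | omega
  · intro τ hτ
    simp only [Finset.mem_filter_univ] at hτ
    exact (hmem _).1 hτ.2

theorem isOpenDerangement_succ_iff {n : ℕ} (k : Fin (n + 1)) (τ : Perm (Fin (n + 1))) :
    (IsOpenDerangement k.val τ ∧ ¬τ.symm k < k) ∧ ¬τ k < k ↔
      IsOpenDerangement (k.val + 1) τ := by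
  constructor
  · rintro ⟨⟨h, h1⟩, h2⟩ i
    refine ⟨fun hi => ?_, (h i).2⟩
    have hk := (h k).2
    rcases eq_or_ne i k with rfl | hik
    · rw [Fin.lt_def] at h2
      rw [ne_eq, Fin.ext_iff] at hk
      omega
    · have hik' : i.val < k.val := by
        rw [ne_eq, Fin.ext_iff] at hik
        omega
      have h3 := (h i).1 hik'
      have h4 : (τ i).val ≠ k.val := fun h5 => by
        rw [← τ.symm_apply_eq.2 (Fin.ext h5).symm] at hik'
        exact h1 hik'
      omega
  · intro h
    refine ⟨⟨fun i => ⟨fun hi => ?_, (h i).2⟩, fun h1 => ?_⟩, fun h2 => ?_⟩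
    · have := (h i).1 (by omega)
      omega
    · have := (h (τ.symm k)).1 (by rw [Fin.lt_def] at h1; omega)
      simp only [apply_symm_apply] at this
      omega
    · have := (h k).1 (by omega)
      rw [Fin.lt_def] at h2
      omega

/-- The letter `k` counts as a newly opened path whose end is at once joined to path `b`, so the
contraction applies with `a = k`. -/
theorem isOpenDerangementOff_succ_iff {n : ℕ} (k b : Fin (n + 1)) (hb : b < k)
    (τ : Perm (Fin (n + 1))) :
    ((IsOpenDerangement k.val τ ∧ ¬τ.symm k < k) ∧ τ k < k) ∧ τ k = b ↔
      IsOpenDerangementOff (k.val + 1) k.val τ ∧ τ k = b := by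
  constructor
  · rintro ⟨⟨⟨h, h1⟩, h2⟩, h3⟩
    refine ⟨fun i hik => ⟨fun hi => ?_, (h i).2⟩, h3⟩
    have hik' : i.val < k.val := by omega
    have h3 := (h i).1 hik'
    have h4 : (τ i).val ≠ k.val := fun h5 => by
      rw [← τ.symm_apply_eq.2 (Fin.ext h5).symm] at hik'
      exact h1 hik'
    omega
  · rintro ⟨h, rfl⟩
    refine ⟨⟨⟨fun i => ?_, fun h1 => ?_⟩, hb⟩, rfl⟩
    · by_cases hi : i.val = k.val
      · obtain rfl := Fin.ext hi
        exact ⟨fun h => absurd h (lt_irrefl _), hb.ne⟩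
      · refine ⟨fun hik => ?_, (h i hi).2⟩
        have := (h i hi).1 (by omega)
        omega
    · have h2 := Fin.lt_def.1 h1
      have := (h (τ.symm k) h2.ne).1 (by omega)
      simp only [apply_symm_apply] at this
      omega

/-- The part of `openSum` in which the letter `k` is not the image of a smaller letter. -/
theorem sum_not_symm_lt {R : Type*} [CommRing R] (x y l : R) {n : ℕ} (k : Fin (n + 1)) :
    ∑ τ with IsOpenDerangement k.val τ ∧ ¬τ.symm k < k, weightFrom x y l k.val τ =
      (if k.val = 0 then 0 else x + (k.val : R) - 1) * openSum x y l n k.val +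
        y * openSum x y l (n + 1) (k.val + 1) := by
  rw [← Finset.sum_filter_add_sum_filter_not _ fun τ : Perm (Fin (n + 1)) => τ k < k,
    Finset.filter_filter, Finset.filter_filter]
  congr 1
  · rw [← Finset.sum_fiberwise_of_maps_to (g := fun τ : Perm (Fin (n + 1)) => τ k)
      (t := Finset.univ.filter fun b : Fin (n + 1) => b.val < k.val),
      ← sum_entryWeight x y k.isLt.le, Finset.sum_mul]
    · refine Finset.sum_congr rfl fun b hb => ?_
      simp only [Finset.mem_filter_univ] at hb
      have hkb : k ≠ b := fun h => by simp [h] at hb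
      have hS := sum_isOpenDerangementOff x y l le_rfl hb.le (a := k) (b := b)
      rw [if_neg hkb, one_mul] at hS
      rw [Finset.filter_filter, ← hS, Finset.mul_sum]
      simp only [isOpenDerangementOff_succ_iff k b hb]
      refine Finset.sum_congr rfl fun τ hτ => ?_
      simp only [Finset.mem_filter_univ] at hτ
      rw [weightFrom_eq_entryWeight_mul x y l k τ
        ((isOpenDerangementOff_succ_iff k b hb τ).2 hτ).1.1.1, hτ.2]
    · intro τ hτ
      simp only [Finset.mem_filter_univ] at hτ ⊢
      exact hτ.2
  · simp only [isOpenDerangement_succ_iff k]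
    rw [openSum, Finset.mul_sum]
    refine Finset.sum_congr rfl fun τ hτ => ?_
    simp only [Finset.mem_filter_univ] at hτ
    have h1 := ((isOpenDerangement_succ_iff k τ).2 hτ).1.1
    have h2 := (hτ k).1 (by omega)
    rw [weightFrom_eq_entryWeight_mul x y l k τ h1, entryWeight, if_pos (by omega)]

theorem openSum_eq_sum_symm_lt_add {R : Type*} [CommRing R] (x y l : R) {n : ℕ}
    (k : Fin (n + 1)) :
    openSum x y l (n + 1) k.val =
      ∑ τ with IsOpenDerangement k.val τ ∧ τ.symm k < k, weightFrom x y l k.val τ +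
      ∑ τ with IsOpenDerangement k.val τ ∧ ¬τ.symm k < k, weightFrom x y l k.val τ := by
  rw [openSum, ← Finset.sum_filter_add_sum_filter_not _
    fun τ : Perm (Fin (n + 1)) => τ.symm k < k, Finset.filter_filter, Finset.filter_filter]

theorem openSum_succ_zero {R : Type*} [CommRing R] (x y l : R) (n : ℕ) :
    openSum x y l (n + 1) 0 = y * openSum x y l (n + 1) 1 := by
  have := openSum_eq_sum_symm_lt_add x y l (0 : Fin (n + 1))
  rw [sum_symm_lt, sum_not_symm_lt] at this
  simpa using this

theorem openSum_succ_succ {R : Type*} [CommRing R] (x y l : R) (n k : ℕ) (hk : k ≤ n) :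
    openSum x y l (n + 2) (k + 1) =
      y * openSum x y l (n + 2) (k + 2) +
      (x + ((k + 1 : ℕ) : R) * y + ((k + 1 : ℕ) : R) - 1) * openSum x y l (n + 1) (k + 1) +
      (l + ((k + 1 : ℕ) : R) - 1) * (x + ((k + 1 : ℕ) : R) - 1) * openSum x y l n k := by
  have h := openSum_eq_sum_symm_lt_add x y l (⟨k + 1, by omega⟩ : Fin (n + 2))
  rw [sum_symm_lt, sum_not_symm_lt] at h
  simp only [Nat.add_eq_zero_iff, one_ne_zero, and_false, if_false] at h
  rw [h, Finset.sum_congr rfl fun a ha => sum_entryWeight_mul_weightFrom x y l a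
    (by simpa [Nat.lt_succ_iff] using ha)]
  have h2 : ∑ a : Fin (n + 1) with a.val < k + 1, ∑ b : Fin (n + 1) with b.val < k + 1,
      entryWeight x y (k + 1) b.val * ((if a = b then l else 1) * openSum x y l n k) =
      (l + ((k + 1 : ℕ) : R) - 1) * (x + ((k + 1 : ℕ) : R) - 1) * openSum x y l n k := by
    have h3 := sum_entryWeight x y (by omega : k + 1 ≤ n + 1)
    rw [if_neg (by omega)] at h3
    rw [Finset.sum_comm, ← h3, mul_assoc, Finset.sum_mul, Finset.mul_sum]
    refine Finset.sum_congr rfl fun b hb => ?_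
    rw [← Finset.mul_sum, ← Finset.sum_mul, sum_filter_lt_ite_eq l (by omega) b (by simpa using hb)]
    ring
  rw [Finset.sum_add_distrib, h2, Finset.sum_const, Fin.card_filter_val_lt,
    min_eq_right (by omega), nsmul_eq_mul]
  ring

/-! ### Boundary values and conclusion -/

theorem openSum_self {R : Type*} [CommRing R] (x y l : R) (n : ℕ) :
    openSum x y l (n + 1) (n + 1) = 0 := by
  rw [openSum, Finset.filter_false_of_mem, Finset.sum_empty]
  intro τ _ h
  have := (h 0).1 (Nat.succ_pos n)
  omega

theorem openSum_zero_right {R : Type*} [CommRing R] (x y l : R) (n : ℕ) :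
    openSum x y l n 0 = derangementPoly n x y l := by
  refine Finset.sum_congr (Finset.filter_congr fun τ _ => ?_) fun τ _ => ?_
  · exact ⟨fun h i => (h i).2, fun h i => ⟨fun hi => absurd hi (Nat.not_lt_zero _), h i⟩⟩
  · simp [weightFrom, rlmFrom, excFrom, rlm, exc]

theorem openSum_zero_zero {R : Type*} [CommRing R] (x y l : R) : openSum x y l 0 0 = 1 := by
  have h := card_parts_partition (1 : Perm (Fin 0))
  have hc : cyc (1 : Perm (Fin 0)) = 0 := by simpa [cyc] using h
  have hu : (Finset.univ : Finset (Perm (Fin 0))) = {1} :=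
    Finset.eq_singleton_iff_unique_mem.2 ⟨Finset.mem_univ _, fun _ _ => Subsingleton.elim _ _⟩
  rw [openSum, Finset.filter_true_of_mem (fun τ _ i => i.elim0), hu, Finset.sum_singleton,
    weightFrom, hc]
  simp [rlmFrom, excFrom]

theorem theorem1p2 {R : Type*} [CommRing R] (x y l : R) :
    IsJFraction (PowerSeries.mk fun n => derangementPoly n x y l)
      (fun n => if n = 0 then 0 else x + (n : R) * y + (n : R) - 1)
      (fun n => (l + (n : R) - 1) * (x + (n : R) - 1) * y) := by
  have h0 : (fun n => derangementPoly n x y l) = fun m => openSum x y l (0 + m) 0 := by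
    funext m
    rw [openSum_zero_right, zero_add]
  rw [h0]
  -- The path length `m` is the number of letters still to be read: `k + m` letters, of which `k`
  -- stand for open paths.
  refine isJFraction_of_recursion _ _ (fun _ => y)
    (fun n => (l + (n : R) - 1) * (x + (n : R) - 1)) (fun k m => openSum x y l (k + m) k)
    (fun s => mul_comm _ _) (openSum_zero_zero x y l) (fun s => openSum_self x y l s) ?_ ?_
  · intro m
    simp only [if_true, zero_mul, add_zero, zero_add]
    rw [openSum_succ_zero, add_comm 1 m]
  · intro s m
    have h := openSum_succ_succ x y l (s + m) s (by omega)
    simp only [Nat.add_eq_zero_iff, one_ne_zero, and_false, if_false]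
    rw [show s + 1 + (m + 1) = s + m + 2 by omega, show s + 2 + m = s + m + 2 by omega,
      show s + 1 + m = s + m + 1 by omega, h]
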